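/- Let $D$ be an equilateral triangle (of positive side length) contained in $[0,1]^2$; $D$ may be open, closed, or contain any part of its boundary. For $n\in\mathbb N$ let $\bar G_n$ be the infinite weighted graph with node set $\bar V_n=\{(\tfrac{i}{n+1},\tfrac{j}{n+1}) : i,j\in\mathbb Z\}$ and symmetric weight function $$w\big((\tfrac{i}{n+1},\tfrac{j}{n+1}),(\tfrac{r}{n+1},\tfrac{s}{n+1})\big)=w_k:=(-1)^{k+1}\frac{2}{k^2}\quad\text{if } (|i-r|,|j-s|)\in\{(k,0),(0,k)\}\text{ with } k\ge 1,$$ and $w=0$ otherwise. Let $V_n=\bar V_n\cap D$, $d_n=|V_n|$, and let $G_n$ be the subgraph of $\bar G_n$ on $V_n$ (all edges of $\bar G_n$ between nodes of $V_n$, with their weights), endowed with a potential $\kappa:V_n\to\mathbb R$ which is either the Dirichlet potential $\kappa(v)=\sum_{u\in\bar V_n\setminus V_n}w(v,u)$ or the Neumann potential $\kappa=0$. Its graph Laplacian is the real symmetric $d_n\times d_n$ matrix $\Delta_{G_n}$ with diagonal entries $\sum_{u\in V_n}w(v,u)+\kappa(v)$ and off-diagonal entries $-w(v,u)$. Then,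 for both choices of the potential, $d_n\to\infty$ and the sequence $\{\Delta_{G_n}\}$ is distributed in the sense of eigenvalues like $\mathfrak f(\theta_1,\theta_2)=\theta_1^2+\theta_2^2$ on $[0,\pi]^2$: for every continuous $F:\mathbb R\to\mathbb R$ with compact support, $$\lim_{n\to\infty}\frac1{d_n}\sum_{k=1}^{d_n}F\big(\lambda_k(\Delta_{G_n})\big)=\frac1{\pi^2}\int_{[0,\pi]^2}F(\theta_1^2+\theta_2^2)\,d\theta_1\,d\theta_2,$$ where $\lambda_1(\Delta_{G_n}),\dots,\lambda_{d_n}(\Delta_{G_n})$ are the eigenvalues of $\Delta_{G_n}$ counted with multiplicity. -/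

import Mathlib

open Filter Topology MeasureTheory

noncomputable section

namespace TriangleGraph

/-! ## Weighted graphs with a potential term and their Laplacians -/

/-- An undirected weighted graph without self-loops, with a potential term.
The edges are the pairs of nodes of nonzero weight; weights may be negative. -/
structure WeightedGraph (V : Type*) where
  weight : V → V → ℝ
  weight_symm : ∀ u v, weight u v = weight v u
  weight_self : ∀ v, weight v v = 0
  potential : V → ℝ

namespace WeightedGraph

variable {V : Type*}

/-- The degree of a node: the sum of the weights of the edges at that node. -/
def degree [Fintype V] (G : WeightedGraph V) (v : V) : ℝ :=
  ∑ u, G.weight v u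

/-- The adjacency matrix. -/
def adjMatrix (G : WeightedGraph V) : Matrix V V ℝ :=
  Matrix.of G.weight

/-- The graph Laplacian `degree matrix + potential matrix - adjacency matrix`. -/
def laplacian [Fintype V] [DecidableEq V] (G : WeightedGraph V) : Matrix V V ℝ :=
  Matrix.diagonal G.degree + Matrix.diagonal G.potential - G.adjMatrix

theorem laplacian_isHermitian [Fintype V] [DecidableEq V] (G : WeightedGraph V) :
    G.laplacian.IsHermitian := by
  have hA : G.adjMatrix.IsHermitian := by
    ext i j
    simp [adjMatrix, G.weight_symm j i]
  exact ((Matrix.isHermitian_diagonal _).add (Matrix.isHermitian_diagonal _)).sub hA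

/-- The subgraph on a finite set `S` of nodes of a host graph: all edges of the host graph
between nodes of `S`, with their weights, together with a new potential term `κ` on `S`. -/
def subgraph (G : WeightedGraph V) (S : Finset V) (κ : S → ℝ) : WeightedGraph S where
  weight u v := G.weight u v
  weight_symm u v := G.weight_symm u v
  weight_self v := G.weight_self v
  potential := κ

/-- The Dirichlet potential of a finite set `S` of nodes of a host graph: the total weight of
the edges of the host graph from a given node of `S` to the nodes outside `S`. -/
def dirichletPotential (G : WeightedGraph V) (S : Finset V) (v : S) : ℝ :=
  ∑' u : {u : V // u ∉ S}, G.weight v u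

end WeightedGraph

/-! ## The infinite 2-level Toeplitz graph -/

/-- The weights `w_k = (-1)^(k+1) * 2 / k^2`, for `k ≥ 1`. -/
def edgeWeight (k : ℕ) : ℝ := (-1) ^ (k + 1) * (2 / (k : ℝ) ^ 2)

/-- The infinite 2-level Toeplitz graph on `ℤ × ℤ`: two different nodes on a common axis-parallel
line, at distance `k`, are joined by an edge of weight `w_k`; the potential vanishes. -/
def hostGraph : WeightedGraph (ℤ × ℤ) where
  weight p q :=
    if p = q then 0
    else if p.2 = q.2 then edgeWeight (p.1 - q.1).natAbs
    else if p.1 = q.1 then edgeWeight (p.2 - q.2).natAbs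
    else 0
  weight_symm p q := by
    rw [← Int.natAbs_neg (p.1 - q.1), ← Int.natAbs_neg (p.2 - q.2), neg_sub, neg_sub]
    congr 1
    · exact propext eq_comm
    · congr 1
      · exact propext eq_comm
      · congr 1
        exact propext eq_comm
  weight_self p := by simp
  potential _ := 0

/-- The series defining Dirichlet potentials converge absolutely. -/
theorem summable_hostGraph_weight (p : ℤ × ℤ) : Summable fun q => hostGraph.weight p q := by
  have h1 : Summable fun i : ℤ => edgeWeight i.natAbs := by
    have h : Summable fun k : ℕ => edgeWeight k := by
      refine Summable.of_norm_bounded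
        (((Real.summable_one_div_nat_pow (p := 2)).2 (by norm_num)).mul_left 2) fun k => ?_
      simp [edgeWeight, div_eq_mul_inv]
    exact Summable.of_nat_of_neg (by simpa using h) (by simpa using h)
  have ha : Summable fun q : ℤ × ℤ =>
      if p.2 = q.2 then edgeWeight (p.1 - q.1).natAbs else 0 := by
    have hinj : Function.Injective fun i : ℤ => ((p.1 - i, p.2) : ℤ × ℤ) := by
      intro i j h
      simpa using h
    refine (hinj.summable_iff ?_).1 (by simpa [Function.comp_def] using h1)
    rintro ⟨a, b⟩ hq
    rw [if_neg]
    rintro rfl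
    exact hq ⟨p.1 - a, by simp⟩
  have hb : Summable fun q : ℤ × ℤ =>
      if p.1 = q.1 then edgeWeight (p.2 - q.2).natAbs else 0 := by
    have hinj : Function.Injective fun i : ℤ => ((p.1, p.2 - i) : ℤ × ℤ) := by
      intro i j h
      simpa using h
    refine (hinj.summable_iff ?_).1 (by simpa [Function.comp_def] using h1)
    rintro ⟨a, b⟩ hq
    rw [if_neg]
    rintro rfl
    exact hq ⟨p.2 - b, by simp⟩
  refine (ha.add hb).congr fun q => ?_
  obtain ⟨a, b⟩ := p
  obtain ⟨c, d⟩ := q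
  have h0 : edgeWeight 0 = 0 := by simp [edgeWeight]
  by_cases h1 : a = c <;> by_cases h2 : b = d <;> simp [hostGraph, h1, h2, h0]

/-! ## Immersion in a planar domain -/

/-- The point `(i / (n + 1), j / (n + 1))` of the plane. -/
def gridPoint (n : ℕ) (p : ℤ × ℤ) : EuclideanSpace ℝ (Fin 2) :=
  !₂[(p.1 : ℝ) / ((n : ℝ) + 1), (p.2 : ℝ) / ((n : ℝ) + 1)]

/-- The closed unit square `[0,1]^2`. -/
def unitSquare : Set (EuclideanSpace ℝ (Fin 2)) :=
  {x | ∀ i, x i ∈ Set.Icc (0 : ℝ) 1}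

open scoped Classical in
/-- The (indices of the) grid points that lie in `D`, for a domain `D` contained in the unit
square. -/
def nodeSet (D : Set (EuclideanSpace ℝ (Fin 2))) (n : ℕ) : Finset (ℤ × ℤ) :=
  (Finset.Icc (0 : ℤ) (n + 1) ×ˢ Finset.Icc (0 : ℤ) (n + 1)).filter fun p => gridPoint n p ∈ D

theorem mem_nodeSet {D : Set (EuclideanSpace ℝ (Fin 2))} (hD : D ⊆ unitSquare) (n : ℕ)
    (p : ℤ × ℤ) : p ∈ nodeSet D n ↔ gridPoint n p ∈ D := by
  simp only [nodeSet, Finset.mem_filter, Finset.mem_product, Finset.mem_Icc, and_iff_right_iff_imp]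
  intro hp
  have hn : (0 : ℝ) < (n : ℝ) + 1 := by positivity
  have key : ∀ i : ℤ, (i : ℝ) / ((n : ℝ) + 1) ∈ Set.Icc (0 : ℝ) 1 → 0 ≤ i ∧ i ≤ n + 1 := by
    rintro i ⟨h0, h1⟩
    rw [le_div_iff₀ hn, zero_mul] at h0
    rw [div_le_one hn] at h1
    exact ⟨by exact_mod_cast h0, by exact_mod_cast h1⟩
  exact ⟨key _ (by simpa [gridPoint] using hD hp 0), key _ (by simpa [gridPoint] using hD hp 1)⟩

/-- The graph immersed in `D`, with the Dirichlet potential. -/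
def dirichletGraph (D : Set (EuclideanSpace ℝ (Fin 2))) (n : ℕ) : WeightedGraph (nodeSet D n) :=
  hostGraph.subgraph (nodeSet D n) (hostGraph.dirichletPotential (nodeSet D n))

/-- The graph immersed in `D`, with the Neumann (zero) potential. -/
def neumannGraph (D : Set (EuclideanSpace ℝ (Fin 2))) (n : ℕ) : WeightedGraph (nodeSet D n) :=
  hostGraph.subgraph (nodeSet D n) (fun _ => 0)

/-! ## Distribution in the sense of eigenvalues -/

/-- A sequence of real symmetric matrices `X n`, of sizes tending to infinity, is distributed like
the real function `f` on `S ⊆ ℝ^m` in the sense of eigenvalues (counted with multiplicity). -/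
def IsEigenvalueDistributed {ι : ℕ → Type} [∀ n, Fintype (ι n)] [∀ n, DecidableEq (ι n)]
    (X : ∀ n, Matrix (ι n) (ι n) ℝ) (hX : ∀ n, (X n).IsHermitian)
    {m : ℕ} (f : (Fin m → ℝ) → ℝ) (S : Set (Fin m → ℝ)) : Prop :=
  Tendsto (fun n => Fintype.card (ι n)) atTop atTop ∧
  ∀ F : ℝ → ℝ, Continuous F → HasCompactSupport F →
    Tendsto (fun n => (1 / (Fintype.card (ι n) : ℝ)) * ∑ k, F ((hX n).eigenvalues k)) atTop
      (𝓝 ((1 / volume.real S) * ∫ y in S, F (f y)))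

end TriangleGraph

end

noncomputable section

namespace TriangleGraph

/-! ## Moments of matrices close to compressions of a convolution operator -/

section Moments

variable {G : Type*} [AddCommGroup G]

/-! The Laplacian of the host graph is convolution on `ℤ × ℤ` with an absolutely summable kernel,
`symbolCoeff`, whose Fourier series is `θ₀ ^ 2 + θ₁ ^ 2`; this is the classical cosine series of `θ
^ 2`, used once per axis. The Dirichlet Laplacian of a finite node set is exactly the compression of
this operator, and the Neumann Laplacian differs from it by a diagonal matrix controlled by the
weight of the cut edges.

The proof is the moment method. All matrices have spectrum in a fixed interval `[-B, B]`, so by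
Weierstrass (`isEigenvalueDistributed_of_moments`) it is enough to find the limits of the normalized
traces of powers. Without truncation, every diagonal entry of the `m`-th power would be
`symbolMoment m 0`, the mean of the `m`-th power of the symbol. Truncation changes the trace by at
most a constant, depending on `m`, times the total weight leaving the node set
(`abs_trace_pow_sub_le`).

Grouped by displacement `w`, that weight is `∑ |symbolCoeff w|` times the number of nodes moved out
by `w` (`sum_leavingWeight_eq`). For fixed `w` such nodes lie near the boundary of a convex body,
hence are a vanishing fraction of all nodes (`tendsto_card_leavingNodes_div`); dominated convergence
in `w` finishes the proof. -/

/-- The `ℓ¹`-distance between a row of a matrix indexed by a finite set `S` and the corresponding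
row of the convolution operator with kernel `t`. -/
def rowDefect (t : G → ℝ) (S : Finset G) (X : Matrix S S ℝ) (v : S) : ℝ :=
  ∑ u : S, |X v u - t (u - v)| + ∑' u : {u : G // u ∉ S}, |t (u - v)|

theorem rowDefect_nonneg (t : G → ℝ) (S : Finset G) (X : Matrix S S ℝ) (v : S) :
    0 ≤ rowDefect t S X v :=
  add_nonneg (Finset.sum_nonneg fun _ _ => abs_nonneg _) (tsum_nonneg fun _ => abs_nonneg _)

/-- Here `τ m` is the `m`-th convolution power of `t`. Passing from `m` to `m + 1` mixes all
entries, so the diagonal alone cannot carry an induction; the error of row `v` is therefore bounded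
uniformly in the column `q`, and only these row bounds are summed. Bounded column sums of `|X|` keep
that sum under control. -/
theorem exists_bound_pow_entry_sub [DecidableEq G] {t : G → ℝ} (ht : Summable fun u => |t u|)
    {τ : ℕ → G → ℝ} {B : ℝ} (hB : 1 ≤ B) (hτ0 : ∀ p, τ 0 p = if p = 0 then 1 else 0)
    (hτ : ∀ m p, HasSum (fun u => t u * τ m (p - u)) (τ (m + 1) p))
    (hτB : ∀ m p, |τ m p| ≤ B ^ m)
    (S : Finset G) (X : Matrix S S ℝ) (hX : ∀ u, ∑ v, |X v u| ≤ B) (m : ℕ) :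
    ∃ e : S → ℝ, (∀ v, 0 ≤ e v) ∧ (∀ v q : S, |(X ^ m) v q - τ m (q - v)| ≤ e v) ∧
      ∑ v, e v ≤ m * B ^ m * ∑ v, rowDefect t S X v := by
  have hB0 : 0 ≤ B := by linarith
  induction m with
  | zero =>
    refine ⟨fun _ => 0, fun _ => le_rfl, fun v q => ?_, by simp⟩
    rw [hτ0, pow_zero, Matrix.one_apply]
    by_cases h : v = q
    · simp [h]
    · rw [if_neg h, if_neg]
      · simp
      · rw [sub_eq_zero]
        exact fun h' => h (Subtype.ext h'.symm)
  | succ m ih =>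
    obtain ⟨e, he0, he, hsum⟩ := ih
    refine ⟨fun v => ∑ u, |X v u| * e u + B ^ m * rowDefect t S X v, fun v => ?_,
      fun v q => ?_, ?_⟩
    · exact add_nonneg (Finset.sum_nonneg fun u _ => mul_nonneg (abs_nonneg _) (he0 u))
        (mul_nonneg (pow_nonneg hB0 m) (rowDefect_nonneg _ _ _ _))
    · have hs : HasSum (fun u : G => t (u - v) * τ m (q - u)) (τ (m + 1) (q - v)) := by
        have := (Equiv.subRight (v : G)).hasSum_iff.2 (hτ m (q - v))
        refine this.congr_fun ?_ |> fun h => h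
        intro u
        simp
      have hst : Summable fun u : G => |t (u - v)| :=
        (Equiv.subRight (v : G)).summable_iff.2 ht
      have hst' : Summable fun u : {u : G // u ∉ S} => |t (u - v)| :=
        hst.comp_injective Subtype.val_injective
      have hsplit := hs.summable.sum_add_tsum_subtype_compl S
      rw [hs.tsum_eq] at hsplit
      have htail : |∑' u : {u : G // u ∉ S}, t (u - v) * τ m (q - u)|
          ≤ B ^ m * ∑' u : {u : G // u ∉ S}, |t (u - v)| := by
        rw [← tsum_mul_left]
        refine tsum_of_norm_bounded (f := fun u : {u : G // u ∉ S} => t (u - v) * τ m (q - u))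
          (hst'.mul_left _).hasSum fun u => ?_
        rw [Real.norm_eq_abs, abs_mul, mul_comm]
        exact mul_le_mul_of_nonneg_right (hτB m _) (abs_nonneg _)
      have hsub : ∑ u ∈ S, t (u - v) * τ m (q - u) = ∑ u : S, t (u - v) * τ m (q - u) :=
        (Finset.sum_coe_sort S fun u => t (u - v) * τ m (q - u)).symm
      -- Telescoping: the error inherited from the power `m`, the error of the new factor inside
      -- `S`, and the part of the convolution that leaves `S`.
      have hdec : (X ^ (m + 1)) v q - τ (m + 1) (q - v)
          = ∑ u : S, X v u * ((X ^ m) u q - τ m (q - u))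
            + ∑ u : S, (X v u - t (u - v)) * τ m (q - u)
            - ∑' u : {u : G // u ∉ S}, t (u - v) * τ m (q - u) := by
        rw [← hsplit, pow_succ', Matrix.mul_apply, hsub, ← Finset.sum_add_distrib,
          ← sub_sub, ← Finset.sum_sub_distrib]
        congr 1
        refine Finset.sum_congr rfl fun u _ => ?_
        ring
      have h1 : |∑ u : S, X v u * ((X ^ m) u q - τ m (q - u))| ≤ ∑ u : S, |X v u| * e u := by
        refine (Finset.abs_sum_le_sum_abs _ _).trans (Finset.sum_le_sum fun u _ => ?_)
        rw [abs_mul]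
        exact mul_le_mul_of_nonneg_left (he u q) (abs_nonneg _)
      have h2 : |∑ u : S, (X v u - t (u - v)) * τ m (q - u)|
          ≤ B ^ m * ∑ u : S, |X v u - t (u - v)| := by
        rw [Finset.mul_sum]
        refine (Finset.abs_sum_le_sum_abs _ _).trans (Finset.sum_le_sum fun u _ => ?_)
        rw [abs_mul, mul_comm]
        exact mul_le_mul_of_nonneg_right (hτB m _) (abs_nonneg _)
      rw [hdec]
      refine (abs_sub _ _).trans ?_
      have := abs_add_le (∑ u : S, X v u * ((X ^ m) u q - τ m (q - u)))
        (∑ u : S, (X v u - t (u - v)) * τ m (q - u))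
      have hdef : rowDefect t S X v = ∑ u : S, |X v u - t (u - v)|
          + ∑' u : {u : G // u ∉ S}, |t (u - v)| := rfl
      dsimp only
      rw [hdef, mul_add]
      linarith
    · have h0 : 0 ≤ ∑ v, rowDefect t S X v := Finset.sum_nonneg fun v _ => rowDefect_nonneg _ _ _ v
      have h1 : ∑ v, ∑ u, |X v u| * e u ≤ B * (m * B ^ m * ∑ v, rowDefect t S X v) := by
        rw [Finset.sum_comm]
        refine le_trans ?_ (mul_le_mul_of_nonneg_left hsum hB0)
        rw [Finset.mul_sum]
        refine Finset.sum_le_sum fun u _ => ?_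
        rw [← Finset.sum_mul]
        exact mul_le_mul_of_nonneg_right (hX u) (he0 u)
      rw [Finset.sum_add_distrib, ← Finset.mul_sum]
      -- `1 ≤ B` absorbs the new term, so that the constants add up to `(m + 1) * B ^ (m + 1)`.
      have h2 : B ^ m * ∑ v, rowDefect t S X v ≤ B ^ (m + 1) * ∑ v, rowDefect t S X v :=
        mul_le_mul_of_nonneg_right (pow_le_pow_right₀ hB (Nat.le_succ m)) h0
      push_cast
      calc _ ≤ B * (m * B ^ m * ∑ v, rowDefect t S X v) + B ^ (m + 1) * ∑ v, rowDefect t S X v :=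
            add_le_add h1 h2
        _ = _ := by ring

theorem abs_trace_pow_sub_le [DecidableEq G] {t : G → ℝ} (ht : Summable fun u => |t u|)
    {τ : ℕ → G → ℝ} {B : ℝ} (hB : 1 ≤ B) (hτ0 : ∀ p, τ 0 p = if p = 0 then 1 else 0)
    (hτ : ∀ m p, HasSum (fun u => t u * τ m (p - u)) (τ (m + 1) p))
    (hτB : ∀ m p, |τ m p| ≤ B ^ m)
    (S : Finset G) (X : Matrix S S ℝ) (hX : ∀ u, ∑ v, |X v u| ≤ B) (m : ℕ) :
    |(X ^ m).trace - S.card * τ m 0| ≤ m * B ^ m * ∑ v, rowDefect t S X v := by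
  obtain ⟨e, -, he, hsum⟩ := exists_bound_pow_entry_sub ht hB hτ0 hτ hτB S X hX m
  refine le_trans ?_ hsum
  have : (X ^ m).trace - S.card * τ m 0 = ∑ v : S, ((X ^ m) v v - τ m (v - v)) := by
    simp [Matrix.trace, Finset.sum_sub_distrib]
  rw [this]
  exact (Finset.abs_sum_le_sum_abs _ _).trans (Finset.sum_le_sum fun v _ => he v v)

end Moments

/-! ## Eigenvalues of symmetric matrices -/

section Eigenvalues

variable {ι : Type*} [Fintype ι] [DecidableEq ι] {X : Matrix ι ι ℝ}

theorem trace_pow_eq_sum_eigenvalues_pow (hX : X.IsHermitian) (m : ℕ) :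
    (X ^ m).trace = ∑ k, hX.eigenvalues k ^ m := by
  conv_lhs => rw [hX.spectral_theorem]
  rw [← map_pow, Unitary.conjStarAlgAut_apply, Matrix.trace_mul_cycle, Unitary.coe_star_mul_self,
    one_mul, Matrix.diagonal_pow, Matrix.trace_diagonal]
  simp

/-- Gershgorin: the eigenvalue lies in a disc centred at some `X v v` whose radius is the sum of the
other absolute entries of that row. -/
theorem abs_eigenvalues_le (hX : X.IsHermitian) {B : ℝ} (hB : ∀ v, ∑ u, |X v u| ≤ B) (k : ι) :
    |hX.eigenvalues k| ≤ B := by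
  have h : Module.End.HasEigenvalue (Matrix.toLin' X) (hX.eigenvalues k) := by
    rw [Module.End.hasEigenvalue_iff_mem_spectrum, Matrix.spectrum_toLin']
    exact hX.eigenvalues_mem_spectrum_real k
  obtain ⟨v, hv⟩ := eigenvalue_mem_ball h
  rw [Metric.mem_closedBall, Real.dist_eq] at hv
  have h1 := Finset.add_sum_erase Finset.univ (fun u => |X v u|) (Finset.mem_univ v)
  have h2 := abs_sub_abs_le_abs_sub (hX.eigenvalues k) (X v v)
  have h3 := hB v
  simp only [Real.norm_eq_abs] at hv
  linarith

end Eigenvalues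

/-- The moment method: convergence of the normalized traces of all powers of a uniformly bounded
sequence of symmetric matrices to the moments of a bounded function gives its distribution in the
sense of eigenvalues. -/
theorem isEigenvalueDistributed_of_moments {ι : ℕ → Type} [∀ n, Fintype (ι n)]
    [∀ n, DecidableEq (ι n)] (X : ∀ n, Matrix (ι n) (ι n) ℝ) (hX : ∀ n, (X n).IsHermitian)
    {m : ℕ} (f : (Fin m → ℝ) → ℝ) (S : Set (Fin m → ℝ)) {B : ℝ}
    (hcard : Tendsto (fun n => Fintype.card (ι n)) atTop atTop)
    (hXB : ∀ n v, ∑ u, |X n v u| ≤ B) (hf : Continuous f) (hS : MeasurableSet S)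
    (hSpos : 0 < volume.real S) (hfB : ∀ y ∈ S, |f y| ≤ B)
    (hmom : ∀ k : ℕ, Tendsto (fun n => (1 / (Fintype.card (ι n) : ℝ)) * (X n ^ k).trace) atTop
      (𝓝 ((1 / volume.real S) * ∫ y in S, f y ^ k))) :
    IsEigenvalueDistributed X hX f S := by
  refine ⟨hcard, fun F hF _ => ?_⟩
  have hSfin : volume S ≠ ⊤ := fun h => by simp [Measure.real, h] at hSpos
  have : IsFiniteMeasure (volume.restrict S) := ⟨by simpa using hSfin.lt_top⟩
  have hint : ∀ g : ℝ → ℝ, Continuous g → IntegrableOn (fun y => g (f y)) S := by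
    intro g hg
    obtain ⟨C, hC⟩ := (isCompact_Icc (a := -B) (b := B)).exists_bound_of_continuousOn hg.continuousOn
    refine Integrable.of_bound (hg.comp hf).aestronglyMeasurable C ?_
    filter_upwards [ae_restrict_mem hS] with y hy
    exact hC _ (abs_le.1 (hfB y hy))
  have hpoly : ∀ p : Polynomial ℝ,
      Tendsto (fun n => (1 / (Fintype.card (ι n) : ℝ)) * ∑ k, p.eval ((hX n).eigenvalues k)) atTop
        (𝓝 ((1 / volume.real S) * ∫ y in S, p.eval (f y))) := by
    intro p
    have h1 : ∀ n, (1 / (Fintype.card (ι n) : ℝ)) * ∑ k, p.eval ((hX n).eigenvalues k)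
        = ∑ i ∈ Finset.range (p.natDegree + 1),
          p.coeff i * ((1 / (Fintype.card (ι n) : ℝ)) * (X n ^ i).trace) := by
      intro n
      simp_rw [Polynomial.eval_eq_sum_range, trace_pow_eq_sum_eigenvalues_pow (hX n)]
      rw [Finset.sum_comm, Finset.mul_sum]
      refine Finset.sum_congr rfl fun i _ => ?_
      rw [← Finset.mul_sum]
      ring
    have h2 : (1 / volume.real S) * ∫ y in S, p.eval (f y)
        = ∑ i ∈ Finset.range (p.natDegree + 1),
          p.coeff i * ((1 / volume.real S) * ∫ y in S, f y ^ i) := by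
      simp_rw [Polynomial.eval_eq_sum_range]
      rw [integral_finsetSum, Finset.mul_sum]
      · refine Finset.sum_congr rfl fun i _ => ?_
        rw [integral_const_mul]
        ring
      · intro i _
        exact (hint (fun x => x ^ i) (continuous_pow i)).const_mul _
    simp_rw [h1, h2]
    exact tendsto_finsetSum _ fun i _ => (hmom i).const_mul _
  rw [Metric.tendsto_atTop]
  intro ε hε
  -- Weierstrass on `[-B, B]`, which contains all eigenvalues and all values of `f` on `S`;
  -- replacing `F` by `p` costs `ε / 3` on each side.
  obtain ⟨p, hp⟩ := exists_polynomial_near_of_continuousOn (-B) B F hF.continuousOn (ε / 3)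
    (by positivity)
  obtain ⟨N, hN⟩ := Metric.tendsto_atTop.1 (hpoly p) (ε / 3) (by positivity)
  refine ⟨N, fun n hn => ?_⟩
  have h1 := hN n hn
  rw [Real.dist_eq] at h1 ⊢
  have h2 : |(1 / (Fintype.card (ι n) : ℝ)) * ∑ k, p.eval ((hX n).eigenvalues k)
      - (1 / (Fintype.card (ι n) : ℝ)) * ∑ k, F ((hX n).eigenvalues k)| ≤ ε / 3 := by
    rw [← mul_sub, ← Finset.sum_sub_distrib, abs_mul, abs_of_nonneg (by positivity)]
    have : |∑ k, (p.eval ((hX n).eigenvalues k) - F ((hX n).eigenvalues k))|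
        ≤ ∑ _k : ι n, ε / 3 := by
      refine (Finset.abs_sum_le_sum_abs _ _).trans (Finset.sum_le_sum fun k _ => ?_)
      exact (hp _ (abs_le.1 (abs_eigenvalues_le (hX n) (hXB n) k))).le
    rw [Finset.sum_const, Finset.card_univ, nsmul_eq_mul] at this
    refine (mul_le_mul_of_nonneg_left this (by positivity)).trans ?_
    -- An empty index set is possible for small `n`; then `1 / 0 = 0`.
    rcases eq_or_ne (Fintype.card (ι n) : ℝ) 0 with h | h
    · rw [h]
      simp only [div_zero, zero_mul]
      positivity
    · rw [← mul_assoc, one_div, inv_mul_cancel₀ h, one_mul]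
  have h3 : |(1 / volume.real S) * (∫ y in S, p.eval (f y))
      - (1 / volume.real S) * (∫ y in S, F (f y))| ≤ ε / 3 := by
    rw [← mul_sub, ← integral_sub (hint _ p.continuous) (hint _ hF), abs_mul,
      abs_of_nonneg (by positivity), one_div_mul_eq_div, div_le_iff₀ hSpos]
    have := norm_integral_le_of_norm_le_const (μ := volume.restrict S)
      (f := fun y => p.eval (f y) - F (f y)) (C := ε / 3) (by
        filter_upwards [ae_restrict_mem hS] with y hy
        exact (hp _ (abs_le.1 (hfB y hy))).le)
    rwa [measureReal_restrict_apply_univ] at this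
  rw [abs_lt] at h1 ⊢
  rw [abs_le] at h2 h3
  constructor <;> linarith

/-! ## Fourier expansion of the symbol -/

/-- The Fourier series of the Bernoulli polynomial `B₂`, evaluated at `(θ + π) / (2π)`: the
half-period shift produces the alternating signs. The term `k = 0` vanishes because `2 / 0 = 0`. -/
theorem hasSum_edgeWeight_mul_cos {θ : ℝ} (hθ : θ ∈ Set.Icc 0 Real.pi) :
    HasSum (fun k : ℕ => edgeWeight k * Real.cos (k * θ)) ((Real.pi ^ 2 / 3 - θ ^ 2) / 2) := by
  have hπ := Real.pi_pos
  have hx : (θ + Real.pi) / (2 * Real.pi) ∈ Set.Icc (0 : ℝ) 1 := by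
    constructor
    · have := hθ.1
      positivity
    · rw [div_le_one (by positivity)]
      linarith [hθ.2]
  have h := (hasSum_one_div_nat_pow_mul_cos one_ne_zero hx).mul_left (-2)
  convert! h using 1
  · funext k
    have : 2 * Real.pi * k * ((θ + Real.pi) / (2 * Real.pi)) = k * θ + k * Real.pi := by
      field_simp
    rw [this, Real.cos_add_nat_mul_pi, edgeWeight, pow_succ]
    ring
  · have hb : (Polynomial.bernoulli 2).map (algebraMap ℚ ℝ)
        = Polynomial.X ^ 2 - Polynomial.X + Polynomial.C (1 / 6) := by
      have h2 : (Polynomial.C (-1 / 2) : Polynomial ℝ) * 2 = -1 := by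
        rw [show (2 : Polynomial ℝ) = Polynomial.C 2 from rfl, ← Polynomial.C_mul]
        norm_num
      rw [Polynomial.bernoulli_def]
      simp [Finset.sum_range_succ, bernoulli_one, bernoulli_two, ← Polynomial.C_mul_X_pow_eq_monomial]
      linear_combination Polynomial.X * h2
    norm_num [hb]
    field_simp
    ring

/-- Expanding `cos ((p - k) θ)` leaves an even series, twice the previous one, and an odd sine
series that cancels. Thus `p ↦ cos (p θ)` is an eigenfunction of convolution with the weights on one
axis. -/
theorem hasSum_int_edgeWeight_mul_cos {θ : ℝ} (hθ : θ ∈ Set.Icc 0 Real.pi) (p : ℤ) :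
    HasSum (fun k : ℤ => edgeWeight k.natAbs * Real.cos ((p - k : ℤ) * θ))
      ((Real.pi ^ 2 / 3 - θ ^ 2) * Real.cos (p * θ)) := by
  have hw0 : edgeWeight 0 = 0 := by simp [edgeWeight]
  have hsum : Summable fun k : ℕ => edgeWeight k := by
    refine Summable.of_norm_bounded
      (((Real.summable_one_div_nat_pow (p := 2)).2 (by norm_num)).mul_left 2) fun k => ?_
    simp [edgeWeight, div_eq_mul_inv]
  have hc : HasSum (fun k : ℤ => edgeWeight k.natAbs * Real.cos (k * θ))
      (Real.pi ^ 2 / 3 - θ ^ 2) := by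
    have h := hasSum_edgeWeight_mul_cos hθ
    have := HasSum.of_nat_of_neg (f := fun k : ℤ => edgeWeight k.natAbs * Real.cos (k * θ))
      (by simpa using h) (by simpa using h)
    convert! this using 1
    simp [hw0]
  have hsin : Summable fun k : ℕ => edgeWeight k * Real.sin (k * θ) := by
    refine Summable.of_norm_bounded hsum.abs fun k => ?_
    rw [Real.norm_eq_abs, abs_mul]
    exact mul_le_of_le_one_right (abs_nonneg _) (Real.abs_sin_le_one _)
  have hs : HasSum (fun k : ℤ => edgeWeight k.natAbs * Real.sin (k * θ)) 0 := by
    have := HasSum.of_nat_of_neg (f := fun k : ℤ => edgeWeight k.natAbs * Real.sin (k * θ))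
      (by simpa using hsin.hasSum) (by simpa using hsin.hasSum.neg)
    convert! this using 1
    simp [hw0]
  have := (hc.mul_left (Real.cos (p * θ))).add (hs.mul_left (Real.sin (p * θ)))
  convert! this using 1
  · funext k
    push_cast
    rw [sub_mul, Real.cos_sub]
    ring
  · ring

theorem hostGraph_weight_zero (u : ℤ × ℤ) : hostGraph.weight 0 u
    = (if u.2 = 0 then edgeWeight u.1.natAbs else 0)
      + (if u.1 = 0 then edgeWeight u.2.natAbs else 0) := by
  have h0 : edgeWeight 0 = 0 := by simp [edgeWeight]
  obtain ⟨a, b⟩ := u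
  by_cases h1 : a = 0 <;> by_cases h2 : b = 0 <;>
    simp [hostGraph, h1, h2, h0, Prod.ext_iff, eq_comm (a := (0 : ℤ))]

theorem hostGraph_weight_eq (p q : ℤ × ℤ) : hostGraph.weight p q = hostGraph.weight 0 (q - p) := by
  simp only [hostGraph, Prod.fst_zero, Prod.snd_zero, zero_sub, Prod.fst_sub, Prod.snd_sub, neg_sub,
    eq_comm (a := (0 : ℤ × ℤ)), eq_comm (a := (0 : ℤ)), sub_eq_zero]
  simp only [eq_comm]

/-- The Fourier coefficients of `θ₀ ^ 2 + θ₁ ^ 2`, which are the entries of the graph Laplacian of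
the host graph. -/
def symbolCoeff (u : ℤ × ℤ) : ℝ :=
  (if u = 0 then 2 * Real.pi ^ 2 / 3 else 0) - hostGraph.weight 0 u

theorem hasSum_hostGraph_weight_mul_cos {θ : Fin 2 → ℝ} (hθ : ∀ i, θ i ∈ Set.Icc 0 Real.pi)
    (p : ℤ × ℤ) :
    HasSum (fun u : ℤ × ℤ => hostGraph.weight 0 u *
        (Real.cos ((p.1 - u.1 : ℤ) * θ 0) * Real.cos ((p.2 - u.2 : ℤ) * θ 1)))
      ((2 * Real.pi ^ 2 / 3 - (θ 0 ^ 2 + θ 1 ^ 2)) *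
        (Real.cos (p.1 * θ 0) * Real.cos (p.2 * θ 1))) := by
  have ha : HasSum (fun u : ℤ × ℤ => (if u.2 = 0 then edgeWeight u.1.natAbs else 0) *
        (Real.cos ((p.1 - u.1 : ℤ) * θ 0) * Real.cos ((p.2 - u.2 : ℤ) * θ 1)))
      ((Real.pi ^ 2 / 3 - θ 0 ^ 2) * Real.cos (p.1 * θ 0) * Real.cos (p.2 * θ 1)) := by
    have hinj : Function.Injective fun i : ℤ => ((i, 0) : ℤ × ℤ) := fun i j h => by simpa using h
    refine (hinj.hasSum_iff ?_).1 ?_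
    · rintro ⟨a, b⟩ hq
      rw [if_neg, zero_mul]
      rintro rfl
      exact hq ⟨a, rfl⟩
    · convert! (hasSum_int_edgeWeight_mul_cos (hθ 0) p.1).mul_right (Real.cos (p.2 * θ 1)) using 1
      funext k
      simp [mul_assoc]
  have hb : HasSum (fun u : ℤ × ℤ => (if u.1 = 0 then edgeWeight u.2.natAbs else 0) *
        (Real.cos ((p.1 - u.1 : ℤ) * θ 0) * Real.cos ((p.2 - u.2 : ℤ) * θ 1)))
      ((Real.pi ^ 2 / 3 - θ 1 ^ 2) * Real.cos (p.2 * θ 1) * Real.cos (p.1 * θ 0)) := by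
    have hinj : Function.Injective fun i : ℤ => ((0, i) : ℤ × ℤ) := fun i j h => by simpa using h
    refine (hinj.hasSum_iff ?_).1 ?_
    · rintro ⟨a, b⟩ hq
      rw [if_neg, zero_mul]
      rintro rfl
      exact hq ⟨b, rfl⟩
    · convert! (hasSum_int_edgeWeight_mul_cos (hθ 1) p.2).mul_right (Real.cos (p.1 * θ 0)) using 1
      funext k
      simp [mul_assoc, mul_comm (Real.cos (p.1 * θ 0))]
  convert! ha.add hb using 1
  · funext u
    rw [hostGraph_weight_zero]
    ring
  · ring

/-- The eigenfunction identity at frequency `0`: every node of the host graph has the same degree,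
which is the diagonal coefficient in `symbolCoeff`. -/
theorem hasSum_hostGraph_weight (p : ℤ × ℤ) :
    HasSum (fun q => hostGraph.weight p q) (2 * Real.pi ^ 2 / 3) := by
  have h := hasSum_hostGraph_weight_mul_cos (θ := 0) (fun _ => ⟨le_rfl, Real.pi_pos.le⟩) 0
  have h' := (Equiv.subRight p).hasSum_iff.2 h
  convert! h' using 1
  · funext q
    simp [hostGraph_weight_eq p q]
  · simp

theorem hasSum_symbolCoeff_mul_cos {θ : Fin 2 → ℝ} (hθ : ∀ i, θ i ∈ Set.Icc 0 Real.pi)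
    (p : ℤ × ℤ) :
    HasSum (fun u : ℤ × ℤ => symbolCoeff u *
        (Real.cos ((p.1 - u.1 : ℤ) * θ 0) * Real.cos ((p.2 - u.2 : ℤ) * θ 1)))
      ((θ 0 ^ 2 + θ 1 ^ 2) * (Real.cos (p.1 * θ 0) * Real.cos (p.2 * θ 1))) := by
  have h0 : HasSum (fun u : ℤ × ℤ => (if u = 0 then 2 * Real.pi ^ 2 / 3 else 0) *
        (Real.cos ((p.1 - u.1 : ℤ) * θ 0) * Real.cos ((p.2 - u.2 : ℤ) * θ 1)))
      (2 * Real.pi ^ 2 / 3 * (Real.cos (p.1 * θ 0) * Real.cos (p.2 * θ 1))) := by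
    have := hasSum_single (f := fun u : ℤ × ℤ => (if u = 0 then 2 * Real.pi ^ 2 / 3 else 0) *
      (Real.cos ((p.1 - u.1 : ℤ) * θ 0) * Real.cos ((p.2 - u.2 : ℤ) * θ 1))) 0
      (fun u hu => by simp [hu])
    simpa using this
  convert! h0.sub (hasSum_hostGraph_weight_mul_cos hθ p) using 1
  · funext u
    rw [symbolCoeff]
    ring
  · ring

theorem summable_abs_symbolCoeff : Summable fun u => |symbolCoeff u| := by
  refine Summable.abs (Summable.sub ?_ (summable_hostGraph_weight 0))
  exact (hasSum_ite_eq (0 : ℤ × ℤ) (2 * Real.pi ^ 2 / 3)).summable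

/-! ## Moments of the symbol -/

/-- The square `[0,π]^2`. -/
def piSquare : Set (Fin 2 → ℝ) := {θ | ∀ i, θ i ∈ Set.Icc 0 Real.pi}

theorem piSquare_eq_pi : piSquare = Set.univ.pi fun _ => Set.Icc 0 Real.pi := by
  ext θ
  simp only [piSquare, Set.mem_ofPred_eq, Set.mem_univ_pi]

theorem measurableSet_piSquare : MeasurableSet piSquare := by
  rw [piSquare_eq_pi]
  exact MeasurableSet.univ_pi fun _ => measurableSet_Icc

theorem volume_real_piSquare : volume.real piSquare = Real.pi ^ 2 := by
  rw [piSquare_eq_pi, Measure.real, volume_pi_pi]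
  simp [Real.pi_pos.le, sq]

theorem isFiniteMeasure_restrict_piSquare : IsFiniteMeasure (volume.restrict piSquare) := by
  refine ⟨?_⟩
  rw [Measure.restrict_apply_univ, piSquare_eq_pi, volume_pi_pi]
  simp

/-- The normalized cosine coefficients of the powers of `θ₀ ^ 2 + θ₁ ^ 2` on `[0,π]^2`. -/
def symbolMoment (m : ℕ) (p : ℤ × ℤ) : ℝ :=
  (1 / volume.real piSquare) * ∫ θ in piSquare, (θ 0 ^ 2 + θ 1 ^ 2) ^ m *
    (Real.cos (p.1 * θ 0) * Real.cos (p.2 * θ 1))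

theorem integral_Icc_cos_int_mul (p : ℤ) :
    ∫ x in Set.Icc 0 Real.pi, Real.cos (p * x) = if p = 0 then Real.pi else 0 := by
  rw [integral_Icc_eq_integral_Ioc, ← intervalIntegral.integral_of_le Real.pi_pos.le]
  split_ifs with h
  · simp [h]
  · have : (p : ℝ) ≠ 0 := by exact_mod_cast h
    rw [intervalIntegral.integral_comp_mul_left _ this]
    simp

theorem symbolMoment_zero (p : ℤ × ℤ) : symbolMoment 0 p = if p = 0 then 1 else 0 := by
  have h := integral_fintype_prod_eq_prod (𝕜 := ℝ)
    (fun i x => Real.cos ((![p.1, p.2] i : ℤ) * x))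
    (μ := fun _ : Fin 2 => volume.restrict (Set.Icc 0 Real.pi))
  rw [← Measure.restrict_pi_pi, ← piSquare_eq_pi, ← volume_pi] at h
  simp only [Fin.prod_univ_two, Matrix.cons_val_zero, Matrix.cons_val_one,
    integral_Icc_cos_int_mul] at h
  have hπ := Real.pi_pos.ne'
  simp only [symbolMoment, pow_zero, one_mul, h, volume_real_piSquare]
  obtain ⟨a, b⟩ := p
  by_cases h1 : a = 0 <;> by_cases h2 : b = 0 <;> simp [h1, h2, Prod.ext_iff]
  field_simp

theorem abs_symbol_le {θ : Fin 2 → ℝ} (hθ : θ ∈ piSquare) :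
    |θ 0 ^ 2 + θ 1 ^ 2| ≤ 2 * Real.pi ^ 2 := by
  rw [abs_of_nonneg (by positivity)]
  have h0 := pow_le_pow_left₀ (hθ 0).1 (hθ 0).2 2
  have h1 := pow_le_pow_left₀ (hθ 1).1 (hθ 1).2 2
  linarith

theorem abs_cos_mul_cos_le (x y : ℝ) : |Real.cos x * Real.cos y| ≤ 1 := by
  rw [abs_mul]
  exact mul_le_one₀ (Real.abs_cos_le_one _) (abs_nonneg _) (Real.abs_cos_le_one _)

theorem abs_symbol_pow_mul_cos_le {θ : Fin 2 → ℝ} (hθ : θ ∈ piSquare) (m : ℕ) (x y : ℝ) :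
    |(θ 0 ^ 2 + θ 1 ^ 2) ^ m * (Real.cos x * Real.cos y)| ≤ (2 * Real.pi ^ 2) ^ m := by
  rw [abs_mul, abs_pow]
  refine (mul_le_of_le_one_right (by positivity) (abs_cos_mul_cos_le x y)).trans ?_
  exact pow_le_pow_left₀ (abs_nonneg _) (abs_symbol_le hθ) m

theorem abs_symbolMoment_le (m : ℕ) (p : ℤ × ℤ) : |symbolMoment m p| ≤ (2 * Real.pi ^ 2) ^ m := by
  have := isFiniteMeasure_restrict_piSquare
  have hπ := Real.pi_pos
  have h := norm_integral_le_of_norm_le_const (μ := volume.restrict piSquare)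
    (f := fun θ => (θ 0 ^ 2 + θ 1 ^ 2) ^ m * (Real.cos (p.1 * θ 0) * Real.cos (p.2 * θ 1)))
    (C := (2 * Real.pi ^ 2) ^ m) (by
      filter_upwards [ae_restrict_mem measurableSet_piSquare] with θ hθ
      exact abs_symbol_pow_mul_cos_le hθ m _ _)
  rw [Real.norm_eq_abs, measureReal_restrict_apply_univ, volume_real_piSquare] at h
  rw [symbolMoment, volume_real_piSquare, abs_mul, abs_of_nonneg (by positivity),
    one_div_mul_eq_div, div_le_iff₀ (by positivity)]
  exact h

/-- Convolving a cosine product with `symbolCoeff` multiplies it by the symbol; integrating term by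
term shows that `symbolMoment m` is the `m`-th convolution power of the kernel. -/
theorem hasSum_symbolMoment (m : ℕ) (p : ℤ × ℤ) :
    HasSum (fun u => symbolCoeff u * symbolMoment m (p - u)) (symbolMoment (m + 1) p) := by
  have := isFiniteMeasure_restrict_piSquare
  have h := hasSum_integral_of_dominated_convergence (μ := volume.restrict piSquare)
    (F := fun (u : ℤ × ℤ) (θ : Fin 2 → ℝ) => symbolCoeff u * ((θ 0 ^ 2 + θ 1 ^ 2) ^ m *
      (Real.cos ((p.1 - u.1 : ℤ) * θ 0) * Real.cos ((p.2 - u.2 : ℤ) * θ 1))))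
    (f := fun θ => (θ 0 ^ 2 + θ 1 ^ 2) ^ (m + 1) *
      (Real.cos (p.1 * θ 0) * Real.cos (p.2 * θ 1)))
    (fun u _ => |symbolCoeff u| * (2 * Real.pi ^ 2) ^ m)
    (fun u => Continuous.aestronglyMeasurable (by fun_prop))
    (fun u => by
      filter_upwards [ae_restrict_mem measurableSet_piSquare] with θ hθ
      rw [Real.norm_eq_abs, abs_mul]
      exact mul_le_mul_of_nonneg_left (abs_symbol_pow_mul_cos_le hθ m _ _) (abs_nonneg _))
    (Eventually.of_forall fun _ => summable_abs_symbolCoeff.mul_right _)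
    (integrable_const _)
    (by
      filter_upwards [ae_restrict_mem measurableSet_piSquare] with θ hθ
      convert! (hasSum_symbolCoeff_mul_cos hθ p).mul_left ((θ 0 ^ 2 + θ 1 ^ 2) ^ m) using 1
      · funext u
        ring
      · ring)
  convert! h.mul_left (1 / volume.real piSquare) using 1
  funext u
  rw [symbolMoment, integral_const_mul]
  simp only [Prod.fst_sub, Prod.snd_sub]
  ring

/-! ## Counting grid points -/

theorem gridPoint_injective (n : ℕ) : Function.Injective (gridPoint n) := by
  have hn : (n : ℝ) + 1 ≠ 0 := by positivity
  rintro ⟨a, b⟩ ⟨c, d⟩ h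
  have h0 := congrArg (fun x => x 0) h
  have h1 := congrArg (fun x => x 1) h
  simp only [gridPoint, PiLp.toLp_apply, Matrix.cons_val_zero, Matrix.cons_val_one] at h0 h1
  rw [div_left_inj' hn] at h0 h1
  exact Prod.ext (by exact_mod_cast h0) (by exact_mod_cast h1)

open scoped Pointwise in
-- Lattice point counting for bounded measurable sets with null frontier; convexity supplies the
-- null frontier.
theorem tendsto_ncard_gridPoint_mem {A : Set (EuclideanSpace ℝ (Fin 2))} (hA : IsCompact A)
    (hA' : Convex ℝ A) :
    Tendsto (fun n : ℕ => ({p | gridPoint n p ∈ A}.ncard : ℝ) / ((n : ℝ) + 1) ^ 2) atTop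
      (𝓝 (volume.real A)) := by
  have hs : IsCompact (WithLp.ofLp '' A) := hA.image (PiLp.continuous_ofLp 2 _)
  have hs' : Convex ℝ (WithLp.ofLp '' A) :=
    hA'.linear_image (WithLp.linearEquiv 2 ℝ (Fin 2 → ℝ)).toLinearMap
  have hpre : WithLp.ofLp '' A = WithLp.toLp 2 ⁻¹' A :=
    (WithLp.equiv 2 (Fin 2 → ℝ)).image_eq_preimage_symm A
  have hvol : volume.real (WithLp.ofLp '' A) = volume.real A := by
    rw [hpre, Measure.real, Measure.real,
      (PiLp.volume_preserving_toLp (Fin 2)).measure_preimage hA.measurableSet.nullMeasurableSet]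
  have h := (tendsto_card_div_pow_atTop_volume _ hs.isBounded hs.measurableSet
    (hs'.addHaar_frontier _)).comp (tendsto_add_atTop_nat 1)
  rw [hvol] at h
  refine h.congr fun n => ?_
  have hn : (n : ℝ) + 1 ≠ 0 := by positivity
  have himg : WithLp.ofLp '' A ∩ ((n + 1 : ℕ) : ℝ)⁻¹ •
      (Submodule.span ℤ (Set.range (Pi.basisFun ℝ (Fin 2))) : Set (Fin 2 → ℝ))
      = (fun p => (gridPoint n p).ofLp) '' {p | gridPoint n p ∈ A} := by
    ext x
    have := BoxIntegral.unitPartition.mem_smul_span_iff (n := n + 1) (v := x)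
    rw [← SetLike.mem_coe, Submodule.coe_pointwise_smul] at this
    rw [Set.mem_inter_iff, this, hpre]
    simp only [Fin.forall_fin_two, Set.mem_preimage, Set.mem_image, Set.mem_ofPred_eq]
    constructor
    · rintro ⟨hx, ⟨a, ha⟩, b, hb⟩
      have hg : gridPoint n (a, b) = WithLp.toLp 2 x := by
        ext i
        simp only [eq_intCast, Nat.cast_add, Nat.cast_one] at ha hb
        fin_cases i
        · simp [gridPoint, ha, hn]
        · simp [gridPoint, hb, hn]
      exact ⟨(a, b), by rwa [hg], by rw [hg]⟩
    · rintro ⟨p, hp, rfl⟩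
      refine ⟨hp, ⟨p.1, ?_⟩, p.2, ?_⟩
      · simp [gridPoint, mul_div_cancel₀ _ hn]
      · simp [gridPoint, mul_div_cancel₀ _ hn]
  have hinj : Function.Injective fun p => (gridPoint n p).ofLp := fun p q hpq =>
    gridPoint_injective n (WithLp.ofLp_injective 2 hpq)
  simp only [Function.comp_apply]
  rw [himg, Nat.card_coe_set_eq, Set.ncard_image_of_injective _ hinj]
  simp

/-- `gridPoint 0` has denominator `1`: it is the plain embedding of `ℤ × ℤ` in the plane. -/
theorem gridPoint_add (n : ℕ) (p u : ℤ × ℤ) :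
    gridPoint n (p + u) = gridPoint n p + (1 / ((n : ℝ) + 1)) • gridPoint 0 u := by
  ext i
  fin_cases i <;> simp [gridPoint] <;> ring

section Domain

variable {D K : Set (EuclideanSpace ℝ (Fin 2))}

theorem coe_nodeSet (hD : D ⊆ unitSquare) (n : ℕ) :
    (nodeSet D n : Set (ℤ × ℤ)) = {p | gridPoint n p ∈ D} := by
  ext p
  exact mem_nodeSet hD n p

theorem finite_gridPoint_mem (hK : K ⊆ unitSquare) (n : ℕ) : {p | gridPoint n p ∈ K}.Finite := by
  rw [← coe_nodeSet hK]
  exact Finset.finite_toSet _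

/-- The nodes that a given translation moves out of the node set. -/
def leavingNodes (D : Set (EuclideanSpace ℝ (Fin 2))) (n : ℕ) (u : ℤ × ℤ) : Finset (ℤ × ℤ) :=
  (nodeSet D n).filter fun v => v + u ∉ nodeSet D n

variable (hK : IsCompact K) (hK' : Convex ℝ K) (hKne : (interior K).Nonempty)
  (hKD : interior K ⊆ D) (hDK : D ⊆ K) (hKs : K ⊆ unitSquare)

theorem volume_real_pos (hK : IsCompact K) (hKne : (interior K).Nonempty) : 0 < volume.real K :=
  ENNReal.toReal_pos (Measure.measure_pos_of_nonempty_interior _ hKne).ne' hK.measure_lt_top.ne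

/-- A convex body contains compact convex sets in its interior of almost the same volume. -/
theorem exists_compact_convex_subset_interior (hK : IsCompact K) (hK' : Convex ℝ K)
    (hKne : (interior K).Nonempty) {ε : ℝ} (hε : 0 < ε) :
    ∃ A, IsCompact A ∧ Convex ℝ A ∧ A ⊆ interior K ∧ volume.real K - ε < volume.real A := by
  obtain ⟨c, hc⟩ := hKne
  have hlim : Tendsto (fun r : ℝ => r ^ 2 * volume.real K) (𝓝[<] 1) (𝓝 (volume.real K)) := by
    have : Continuous fun r : ℝ => r ^ 2 * volume.real K := by fun_prop
    simpa using (this.tendsto 1).mono_left nhdsWithin_le_nhds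
  obtain ⟨r, hr, hr0, hr1⟩ := ((hlim.eventually (lt_mem_nhds (sub_lt_self _ hε))).and
    (Ioo_mem_nhdsLT (zero_lt_one' ℝ))).exists
  -- Shrinking towards an interior point `c` by a ratio `r < 1` moves `K` into its interior and
  -- multiplies the area by `r ^ 2`, close to `1`.
  refine ⟨AffineMap.homothety c r '' K, hK.image (AffineMap.homothety_continuous c r),
    hK'.affine_image _, ?_, ?_⟩
  · rintro _ ⟨x, hx, rfl⟩
    rw [AffineMap.homothety_apply, vsub_eq_sub, vadd_eq_add]
    have := hK'.add_smul_sub_mem_interior' (subset_closure hx) hc (t := 1 - r)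
      ⟨by linarith, by linarith⟩
    convert! this using 1
    module
  · rw [measureReal_def volume (_ '' _), Measure.addHaar_image_homothety, ENNReal.toReal_mul,
      ENNReal.toReal_ofReal (abs_nonneg _), finrank_euclideanSpace_fin, abs_of_nonneg (sq_nonneg r)]
    exact hr

include hK hK' hKne hKD hDK hKs

/-- No regularity of the boundary part of `D` is available, so the count is squeezed between those
of `K` and of compact convex subsets of its interior. -/
theorem tendsto_card_nodeSet_div :
    Tendsto (fun n => ((nodeSet D n).card : ℝ) / ((n : ℝ) + 1) ^ 2) atTop
      (𝓝 (volume.real K)) := by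
  have hcard : ∀ n, (nodeSet D n).card = {p | gridPoint n p ∈ D}.ncard := fun n => by
    rw [← coe_nodeSet (hDK.trans hKs), Set.ncard_coe_finset]
  have hfin := finite_gridPoint_mem hKs
  rw [tendsto_order]
  constructor
  · intro a ha
    obtain ⟨A, hA, hA', hAK, hvol⟩ :=
      exists_compact_convex_subset_interior hK hK' hKne (sub_pos.2 ha)
    rw [sub_sub_cancel] at hvol
    filter_upwards [(tendsto_ncard_gridPoint_mem hA hA').eventually (lt_mem_nhds hvol)] with n hn
    refine hn.trans_le ?_
    rw [hcard]
    gcongr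
    · exact (hfin n).subset fun p hp => hDK hp
    · exact hAK.trans hKD
  · intro a ha
    filter_upwards [(tendsto_ncard_gridPoint_mem hK hK').eventually (gt_mem_nhds ha)] with n hn
    refine lt_of_le_of_lt ?_ hn
    rw [hcard]
    gcongr
    exact hfin n

/-- A compact `A` inside the interior has a margin `δ`; once the translation is shorter than `δ`, no
node in `A` can leave. The leaving nodes then lie in `K \ A`, of area less than `ε`. -/
theorem tendsto_card_leavingNodes_div (u : ℤ × ℤ) :
    Tendsto (fun n => ((leavingNodes D n u).card : ℝ) / ((n : ℝ) + 1) ^ 2) atTop (𝓝 0) := by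
  have hfin := finite_gridPoint_mem hKs
  rw [tendsto_order]
  refine ⟨fun a ha => Eventually.of_forall fun n => ha.trans_le (by positivity), fun ε hε => ?_⟩
  obtain ⟨A, hA, hA', hAK, hvol⟩ := exists_compact_convex_subset_interior hK hK' hKne hε
  obtain ⟨δ, hδ, hδA⟩ := hA.exists_thickening_subset_open isOpen_interior hAK
  have h1 := (tendsto_ncard_gridPoint_mem hK hK').sub (tendsto_ncard_gridPoint_mem hA hA')
  have h2 : Tendsto (fun n : ℕ => 1 / ((n : ℝ) + 1) * ‖gridPoint 0 u‖) atTop (𝓝 0) := by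
    simpa using tendsto_one_div_add_atTop_nhds_zero_nat.mul_const ‖gridPoint 0 u‖
  filter_upwards [h1.eventually (gt_mem_nhds (show volume.real K - volume.real A < ε by linarith)),
    h2.eventually (gt_mem_nhds hδ)] with n hn1 hn2
  refine lt_of_le_of_lt ?_ hn1
  rw [← sub_div]
  gcongr
  rw [le_sub_iff_add_le]
  have hdisj : Disjoint (leavingNodes D n u : Set (ℤ × ℤ)) {p | gridPoint n p ∈ A} := by
    rw [Set.disjoint_left]
    intro p hp hpA
    refine (Finset.mem_filter.1 (Finset.mem_coe.1 hp)).2 ?_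
    rw [mem_nodeSet (hDK.trans hKs)]
    refine hKD (hδA (Metric.mem_thickening_iff.2 ⟨_, hpA, ?_⟩))
    rw [gridPoint_add, dist_eq_norm, add_sub_cancel_left, norm_smul, Real.norm_eq_abs,
      abs_of_nonneg (by positivity)]
    exact hn2
  have hAfin : {p | gridPoint n p ∈ A}.Finite :=
    (hfin n).subset fun p hp => (hAK.trans interior_subset) hp
  have hle : (leavingNodes D n u).card + {p | gridPoint n p ∈ A}.ncard
      ≤ {p | gridPoint n p ∈ K}.ncard := by
    rw [← Set.ncard_coe_finset, ← Set.ncard_union_eq hdisj (Finset.finite_toSet _) hAfin]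
    refine Set.ncard_le_ncard (Set.union_subset ?_ ?_) (hfin n)
    · intro p hp
      exact hDK ((mem_nodeSet (hDK.trans hKs) n p).1 (Finset.mem_filter.1 (Finset.mem_coe.1 hp)).1)
    · intro p hp
      exact (hAK.trans interior_subset) hp
  exact_mod_cast hle

end Domain

/-! ## Laplacians of subgraphs of the host graph -/

theorem summable_abs_symbolCoeff_sub (v : ℤ × ℤ) : Summable fun u => |symbolCoeff (u - v)| :=
  (Equiv.subRight v).summable_iff.2 summable_abs_symbolCoeff

/-- The total absolute weight of the edges of the host graph from a node of `S` to the nodes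
outside `S`. -/
def leavingWeight (S : Finset (ℤ × ℤ)) (v : S) : ℝ :=
  ∑' u : {u : ℤ × ℤ // u ∉ S}, |symbolCoeff (u - v)|

theorem leavingWeight_nonneg (S : Finset (ℤ × ℤ)) (v : S) : 0 ≤ leavingWeight S v :=
  tsum_nonneg fun _ => abs_nonneg _

theorem symbolCoeff_sub_of_ne {u v : ℤ × ℤ} (h : u ≠ v) :
    symbolCoeff (u - v) = -hostGraph.weight v u := by
  rw [symbolCoeff, if_neg (sub_ne_zero.2 h), zero_sub, hostGraph_weight_eq v u]

theorem abs_dirichletPotential_le (S : Finset (ℤ × ℤ)) (v : S) :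
    |hostGraph.dirichletPotential S v| ≤ leavingWeight S v := by
  refine tsum_of_norm_bounded (f := fun u : {u : ℤ × ℤ // u ∉ S} => hostGraph.weight v u)
    (g := fun u => |symbolCoeff (u - v)|)
    ((summable_abs_symbolCoeff_sub (v : ℤ × ℤ)).comp_injective
      Subtype.val_injective).hasSum fun u => ?_
  rw [symbolCoeff_sub_of_ne, abs_neg, Real.norm_eq_abs]
  rintro h
  exact u.2 (h ▸ v.2)

/-- Degree inside `S` plus Dirichlet potential is the constant full degree, so the Dirichlet choice
of `κ` gives the exact compression. -/
theorem laplacian_subgraph_sub_symbolCoeff (S : Finset (ℤ × ℤ)) (κ : S → ℝ) (v u : S) :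
    (hostGraph.subgraph S κ).laplacian v u - symbolCoeff (u - v)
      = if v = u then κ v - hostGraph.dirichletPotential S v else 0 := by
  by_cases h : v = u
  · subst h
    have hsum := (summable_hostGraph_weight v).sum_add_tsum_subtype_compl S
    rw [(hasSum_hostGraph_weight v).tsum_eq, ← Finset.sum_coe_sort] at hsum
    simp only [WeightedGraph.laplacian, Matrix.sub_apply, Matrix.add_apply,
      Matrix.diagonal_apply_eq, WeightedGraph.degree, WeightedGraph.subgraph,
      WeightedGraph.adjMatrix, Matrix.of_apply, WeightedGraph.dirichletPotential, if_true,
      symbolCoeff, sub_self, hostGraph.weight_self]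
    linarith
  · have h' : (u : ℤ × ℤ) ≠ v := fun h' => h (Subtype.ext h'.symm)
    simp [WeightedGraph.laplacian, WeightedGraph.subgraph, WeightedGraph.adjMatrix, h,
      symbolCoeff_sub_of_ne h']

section Subgraph

variable {S : Finset (ℤ × ℤ)} {κ : S → ℝ}

/-- The hypothesis on `κ` treats both potentials at once: the difference is `0` for Dirichlet, and
minus the Dirichlet potential for Neumann. -/
theorem sum_abs_laplacian_sub_le
    (hκ : ∀ v, |κ v - hostGraph.dirichletPotential S v| ≤ leavingWeight S v) (v : S) :
    ∑ u : S, |(hostGraph.subgraph S κ).laplacian v u - symbolCoeff (u - v)|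
      ≤ leavingWeight S v := by
  simp_rw [laplacian_subgraph_sub_symbolCoeff, apply_ite abs, abs_zero]
  simpa using hκ v

theorem rowDefect_laplacian_le
    (hκ : ∀ v, |κ v - hostGraph.dirichletPotential S v| ≤ leavingWeight S v) (v : S) :
    rowDefect symbolCoeff S (hostGraph.subgraph S κ).laplacian v ≤ 2 * leavingWeight S v := by
  have h := sum_abs_laplacian_sub_le hκ v
  rw [two_mul]
  exact add_le_add h le_rfl

theorem sum_abs_laplacian_le
    (hκ : ∀ v, |κ v - hostGraph.dirichletPotential S v| ≤ leavingWeight S v) (v : S) :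
    ∑ u, |(hostGraph.subgraph S κ).laplacian v u| ≤ ∑' u, |symbolCoeff u| := by
  have h1 := (summable_abs_symbolCoeff_sub (v : ℤ × ℤ)).sum_add_tsum_subtype_compl S
  have h2 : ∑' u, |symbolCoeff (u - v)| = ∑' u, |symbolCoeff u| :=
    (Equiv.subRight (v : ℤ × ℤ)).tsum_eq fun u => |symbolCoeff u|
  rw [h2, ← Finset.sum_coe_sort] at h1
  have h3 := sum_abs_laplacian_sub_le hκ v
  have h4 : ∑ u, |(hostGraph.subgraph S κ).laplacian v u|
      ≤ ∑ u : S, (|(hostGraph.subgraph S κ).laplacian v u - symbolCoeff (u - v)|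
        + |symbolCoeff (u - v)|) := by
    refine Finset.sum_le_sum fun u _ => ?_
    simpa using abs_add_le ((hostGraph.subgraph S κ).laplacian v u - symbolCoeff (u - v))
      (symbolCoeff (u - v))
  rw [Finset.sum_add_distrib] at h4
  rw [leavingWeight] at h3
  linarith

end Subgraph

/-- Double counting of the pairs `(v, u)` with `u` outside `S`, grouped by the displacement `w = u -
v`. -/
theorem sum_leavingWeight_eq (S : Finset (ℤ × ℤ)) :
    ∑ v, leavingWeight S v
      = ∑' w, |symbolCoeff w| * ((S.filter fun v => v + w ∉ S).card : ℝ) := by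
  have h : ∀ v : S, leavingWeight S v
      = ∑' w, |symbolCoeff w| * (if (v : ℤ × ℤ) + w ∉ S then 1 else 0) := by
    intro v
    rw [leavingWeight, ← (Equiv.subRight (v : ℤ × ℤ)).tsum_eq
      fun w => |symbolCoeff w| * (if (v : ℤ × ℤ) + w ∉ S then (1 : ℝ) else 0)]
    refine (tsum_subtype {u | u ∉ S} fun u => |symbolCoeff (u - v)|).trans ?_
    refine tsum_congr fun u => ?_
    simp [Set.indicator_apply]
  simp_rw [h]
  rw [Finset.sum_coe_sort S fun v => ∑' w, |symbolCoeff w| * (if v + w ∉ S then (1 : ℝ) else 0),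
    ← Summable.tsum_finsetSum]
  · refine tsum_congr fun w => ?_
    rw [← Finset.mul_sum, Finset.sum_boole]
  · intro v _
    refine Summable.of_nonneg_of_le (fun w => by positivity) (fun w => ?_) summable_abs_symbolCoeff
    refine mul_le_of_le_one_right (abs_nonneg _) ?_
    split_ifs <;> simp

/-! ## Distribution of the eigenvalues for nearly convex domains -/

section Domain

variable {D K : Set (EuclideanSpace ℝ (Fin 2))} (hK : IsCompact K) (hK' : Convex ℝ K)
  (hKne : (interior K).Nonempty) (hKD : interior K ⊆ D) (hDK : D ⊆ K) (hKs : K ⊆ unitSquare)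

include hK hK' hKne hKD hDK hKs

theorem tendsto_card_nodeSet : Tendsto (fun n => (nodeSet D n).card) atTop atTop := by
  rw [← tendsto_natCast_atTop_iff (R := ℝ)]
  have h1 := tendsto_card_nodeSet_div hK hK' hKne hKD hDK hKs
  have h2 : Tendsto (fun n : ℕ => ((n : ℝ) + 1) ^ 2) atTop atTop :=
    (tendsto_pow_atTop two_ne_zero).comp
      (tendsto_atTop_add_const_right _ _ tendsto_natCast_atTop_atTop)
  refine (h1.pos_mul_atTop (volume_real_pos hK hKne) h2).congr fun n => ?_
  have : (n : ℝ) + 1 ≠ 0 := by positivity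
  field_simp

theorem tendsto_card_leavingNodes_div_card (u : ℤ × ℤ) :
    Tendsto (fun n => ((leavingNodes D n u).card : ℝ) / (nodeSet D n).card) atTop (𝓝 0) := by
  have h := (tendsto_card_leavingNodes_div hK hK' hKne hKD hDK hKs u).div
    (tendsto_card_nodeSet_div hK hK' hKne hKD hDK hKs) (volume_real_pos hK hKne).ne'
  rw [zero_div] at h
  refine h.congr fun n => ?_
  have : ((n : ℝ) + 1) ^ 2 ≠ 0 := by positivity
  exact div_div_div_cancel_right₀ this _ _

theorem tendsto_sum_leavingWeight_div :
    Tendsto (fun n => (∑ v, leavingWeight (nodeSet D n) v) / (nodeSet D n).card) atTop (𝓝 0) := by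
  have h := tendsto_tsum_of_dominated_convergence (𝓕 := atTop)
    (f := fun n w => |symbolCoeff w| * (((leavingNodes D n w).card : ℝ) / (nodeSet D n).card))
    (g := fun _ => 0) summable_abs_symbolCoeff
    (fun w => by
      simpa using (tendsto_card_leavingNodes_div_card hK hK' hKne hKD hDK hKs w).const_mul
        |symbolCoeff w|)
    (Eventually.of_forall fun n w => by
      rw [Real.norm_eq_abs, abs_of_nonneg (by positivity)]
      refine mul_le_of_le_one_right (abs_nonneg _) (div_le_one_of_le₀ ?_ (by positivity))
      exact_mod_cast Finset.card_filter_le _ _)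
  rw [tsum_zero] at h
  refine h.congr fun n => ?_
  rw [sum_leavingWeight_eq, ← tsum_div_const]
  exact tsum_congr fun w => (mul_div_assoc _ _ _).symm

theorem isEigenvalueDistributed_laplacian (κ : ∀ n, nodeSet D n → ℝ)
    (hκ : ∀ n v, |κ n v - hostGraph.dirichletPotential (nodeSet D n) v|
      ≤ leavingWeight (nodeSet D n) v) :
    IsEigenvalueDistributed
      (fun n => (hostGraph.subgraph (nodeSet D n) (κ n)).laplacian)
      (fun n => (hostGraph.subgraph (nodeSet D n) (κ n)).laplacian_isHermitian)
      (fun θ : Fin 2 → ℝ => θ 0 ^ 2 + θ 1 ^ 2) piSquare := by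
  have hπ := Real.pi_pos
  -- One constant serves three purposes: it bounds the row sums, bounds the symbol on `piSquare`,
  -- and is at least `1`.
  set B := ∑' u, |symbolCoeff u| + 2 * Real.pi ^ 2 + 1 with hB
  have hT : 0 ≤ ∑' u, |symbolCoeff u| := tsum_nonneg fun _ => abs_nonneg _
  have hπ2 : 0 < 2 * Real.pi ^ 2 := by positivity
  have hrow : ∀ n v, ∑ u, |(hostGraph.subgraph (nodeSet D n) (κ n)).laplacian v u| ≤ B :=
    fun n v => (sum_abs_laplacian_le (hκ n) v).trans (by linarith)
  have hcol : ∀ n u, ∑ v, |(hostGraph.subgraph (nodeSet D n) (κ n)).laplacian v u| ≤ B := by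
    intro n u
    refine le_of_eq_of_le (Finset.sum_congr rfl fun v _ => ?_) (hrow n u)
    rw [← (hostGraph.subgraph (nodeSet D n) (κ n)).laplacian_isHermitian.apply v u]
    rfl
  have hcard := tendsto_card_nodeSet hK hK' hKne hKD hDK hKs
  refine isEigenvalueDistributed_of_moments _ _ _ _ (B := B) (by simpa using hcard) hrow
    (by fun_prop) measurableSet_piSquare (by rw [volume_real_piSquare]; positivity)
    (fun y hy => (abs_symbol_le hy).trans (by linarith)) fun m => ?_
  have hmom : (1 / volume.real piSquare) * ∫ θ in piSquare, (θ 0 ^ 2 + θ 1 ^ 2) ^ m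
      = symbolMoment m 0 := by
    simp [symbolMoment]
  rw [hmom, tendsto_iff_norm_sub_tendsto_zero]
  have hlim := (tendsto_sum_leavingWeight_div hK hK' hKne hKD hDK hKs).const_mul (m * B ^ m * 2)
  rw [mul_zero] at hlim
  refine squeeze_zero' (Eventually.of_forall fun _ => norm_nonneg _) ?_ hlim
  filter_upwards [hcard.eventually_gt_atTop 0] with n hn
  have hn' : (0 : ℝ) < (nodeSet D n).card := by exact_mod_cast hn
  have h := abs_trace_pow_sub_le summable_abs_symbolCoeff (B := B) (by linarith)
    symbolMoment_zero hasSum_symbolMoment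
    (fun k p => (abs_symbolMoment_le k p).trans
      (pow_le_pow_left₀ hπ2.le (by linarith) k)) (nodeSet D n)
    (hostGraph.subgraph (nodeSet D n) (κ n)).laplacian (hcol n) m
  have h2 : ∑ v, rowDefect symbolCoeff (nodeSet D n)
      (hostGraph.subgraph (nodeSet D n) (κ n)).laplacian v
      ≤ 2 * ∑ v, leavingWeight (nodeSet D n) v := by
    rw [Finset.mul_sum]
    exact Finset.sum_le_sum fun v _ => rowDefect_laplacian_le (hκ n) v
  have h3 : ∀ x : ℝ, 1 / ((nodeSet D n).card : ℝ) * x - symbolMoment m 0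
      = (x - (nodeSet D n).card * symbolMoment m 0) / (nodeSet D n).card := by
    intro x
    field_simp
  rw [Fintype.card_coe, h3, norm_div, Real.norm_eq_abs, Real.norm_eq_abs, abs_of_pos hn',
    ← mul_div_assoc]
  gcongr
  refine h.trans ?_
  rw [mul_assoc _ (2 : ℝ)]
  have : 0 ≤ m * B ^ m := mul_nonneg (Nat.cast_nonneg _) (pow_nonneg (by linarith) _)
  exact mul_le_mul_of_nonneg_left h2 this

end Domain

/-! ## Triangles -/

section Triangle

variable (T : Affine.Triangle ℝ (EuclideanSpace ℝ (Fin 2)))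

theorem interior_closedInterior_triangle : interior T.closedInterior = T.interior ∧
    (interior T.closedInterior).Nonempty := by
  let b : AffineBasis (Fin 3) ℝ (EuclideanSpace ℝ (Fin 2)) :=
    ⟨T.points, T.independent, by
      rw [T.independent.affineSpan_eq_top_iff_card_eq_finrank_add_one]
      simp⟩
  have hb : T.closedInterior = convexHull ℝ (Set.range b) :=
    T.convexHull_eq_closedInterior.symm
  refine ⟨?_, ?_⟩
  · rw [hb, b.interior_convexHull]
    ext x
    have hx : Finset.univ.affineCombination ℝ T.points (fun i => b.coord i x) = x :=
      b.affineCombination_coord_eq_self x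
    have hsum : ∑ i, b.coord i x = 1 := b.sum_coord_apply_eq_one x
    rw [← hx, Affine.Simplex.affineCombination_mem_interior_iff hsum, hx]
    -- `T.interior` also asks for coordinates below `1`; this is automatic for three positive
    -- numbers of sum `1`.
    refine ⟨fun h i => ⟨h i, ?_⟩, fun h i => (h i).1⟩
    rw [Fin.sum_univ_three] at hsum
    have h0 := h 0
    have h1 := h 1
    have h2 := h 2
    fin_cases i <;> simp only [Fin.zero_eta, Fin.mk_one, Fin.reduceFinMk] <;> linarith
  · rw [hb]
    exact ⟨_, b.centroid_mem_interior_convexHull⟩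

theorem isClosed_unitSquare : IsClosed unitSquare := by
  simp only [unitSquare, Set.ofPred_forall]
  exact isClosed_iInter fun i => isClosed_Icc.preimage (by fun_prop)

theorem isEigenvalueDistributed_laplacian_triangle {D : Set (EuclideanSpace ℝ (Fin 2))}
    (hTD : T.interior ⊆ D) (hDT : D ⊆ T.closedInterior) (hD : D ⊆ unitSquare)
    (κ : ∀ n, nodeSet D n → ℝ)
    (hκ : ∀ n v, |κ n v - hostGraph.dirichletPotential (nodeSet D n) v|
      ≤ leavingWeight (nodeSet D n) v) :
    IsEigenvalueDistributed
      (fun n => (hostGraph.subgraph (nodeSet D n) (κ n)).laplacian)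
      (fun n => (hostGraph.subgraph (nodeSet D n) (κ n)).laplacian_isHermitian)
      (fun θ : Fin 2 → ℝ => θ 0 ^ 2 + θ 1 ^ 2) piSquare := by
  obtain ⟨hint, hne⟩ := interior_closedInterior_triangle T
  have hconv : Convex ℝ T.closedInterior := by
    rw [← T.convexHull_eq_closedInterior]
    exact convex_convexHull ℝ _
  have hcomp : IsCompact T.closedInterior := by
    rw [← T.convexHull_eq_closedInterior]
    exact (Set.finite_range _).isCompact_convexHull (𝕜 := ℝ)
  refine isEigenvalueDistributed_laplacian hcomp hconv hne (hint.trans_subset hTD) hDT ?_ κ hκ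
  -- Only `D` is known to lie in the square; the closed triangle follows as the closure of its
  -- interior.
  calc T.closedInterior ⊆ closure (interior T.closedInterior) := by
        rw [hconv.closure_interior_eq_closure_of_nonempty_interior hne]
        exact subset_closure
    _ ⊆ unitSquare := closure_minimal ((hint.trans_subset hTD).trans hD) isClosed_unitSquare

end Triangle

end TriangleGraph

end

theorem mainTheorem1
    (T : Affine.Triangle ℝ (EuclideanSpace ℝ (Fin 2))) (hT : T.Equilateral)
    (D : Set (EuclideanSpace ℝ (Fin 2)))
    (hTD : T.interior ⊆ D) (hDT : D ⊆ T.closedInterior)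
    (hD : D ⊆ TriangleGraph.unitSquare) :
    TriangleGraph.IsEigenvalueDistributed
        (fun n => (TriangleGraph.dirichletGraph D n).laplacian)
        (fun n => (TriangleGraph.dirichletGraph D n).laplacian_isHermitian)
        (fun θ : Fin 2 → ℝ => θ 0 ^ 2 + θ 1 ^ 2)
        {θ : Fin 2 → ℝ | ∀ i, θ i ∈ Set.Icc 0 Real.pi} ∧
      TriangleGraph.IsEigenvalueDistributed
        (fun n => (TriangleGraph.neumannGraph D n).laplacian)
        (fun n => (TriangleGraph.neumannGraph D n).laplacian_isHermitian)
        (fun θ : Fin 2 → ℝ => θ 0 ^ 2 + θ 1 ^ 2)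
        {θ : Fin 2 → ℝ | ∀ i, θ i ∈ Set.Icc 0 Real.pi} := by
  constructor
  · refine TriangleGraph.isEigenvalueDistributed_laplacian_triangle T hTD hDT hD
      (fun n => TriangleGraph.hostGraph.dirichletPotential (TriangleGraph.nodeSet D n)) ?_
    intro n v
    rw [sub_self, abs_zero]
    exact TriangleGraph.leavingWeight_nonneg _ _
  · refine TriangleGraph.isEigenvalueDistributed_laplacian_triangle T hTD hDT hD
      (fun n _ => 0) ?_
    intro n v
    rw [zero_sub, abs_neg]
    exact TriangleGraph.abs_dirichletPotential_le _ _
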